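/- Let $p$ be a prime, let $d\ge 2$, and let $1\ne g\in \mathrm{GL}(d,\mathbb{F}_p)$. Let $V$ be a finite-dimensional $\mathbb{F}_p\langle g\rangle$-module on which $g$ acts non-trivially, and let $M$ be an $\mathbb{F}_p\langle g\rangle$-module that is an extension of $V\wedge V$ by $V$, i.e. there is a short exact sequence $0\to V\wedge V\to M\to V\to 0$ of $\mathbb{F}_p\langle g\rangle$-modules, where $g$ acts on $V\wedge V$ by $g(x\wedge y)=gx\wedge gy$. Let $v=\dim_{\mathbb{F}_p}V$ and $m=\dim_{\mathbb{F}_p}M$, and let $S_M$ be the number of $\mathbb{F}_p\langle g\rangle$-submodules of $M$. Put \[ C(p)=\sum_{r=-\infty}^{\infty}p^{-r^2},\qquad D(p)=\prod_{j=1}^{\infty}\frac{1}{1-p^{-j}},\qquad \varepsilon=\log_p\bigl(C(p)D(p)\bigr). \] Then $m=v(v+1)/2$, $S_M$ is finite, and \[ \log_p S_M\le \frac{(m-4)^2}{4}+C,\qquad\text{where}\quad C=\begin{cases}\varepsilon+2m-4 & \text{if } m\le 45,\\ 5\varepsilon+4 & \text{if } m>45.\end{cases} \] -/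

import Mathlib

/-- The theta-type sum `C(x) = ∑_{r ∈ ℤ} x^{-r²}` (convergent for `x > 1`). -/
noncomputable def thetaSum (x : ℝ) : ℝ :=
  ∑' r : ℤ, x ^ (-(r ^ 2))

/-- The Euler-type product `D(x) = ∏_{j ≥ 1} 1 / (1 - x^{-j})` (convergent for `x > 1`).
The index is shifted by one, so that it runs over all natural numbers. -/
noncomputable def eulerProd (x : ℝ) : ℝ :=
  ∏' j : ℕ, 1 / (1 - x ^ (-((j : ℤ) + 1)))

/-- The exterior square `V ∧ V` of a representation `V`: the space `⋀² V` with the action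
`h (x ∧ y) = h x ∧ h y`. -/
noncomputable def exteriorSquareRep {K G V : Type*} [CommRing K] [Monoid G] [AddCommGroup V]
    [Module K V] (ρ : Representation K G V) : Representation K G (⋀[K]^2 V) where
  toFun h := exteriorPower.map 2 (ρ h)
  map_one' := by
    rw [map_one]
    exact exteriorPower.map_id
  map_mul' a b := by
    rw [map_mul]
    exact exteriorPower.map_comp (ρ b) (ρ a)

/-- The representation `M` is an extension of `A` by `B`: there is a short exact sequence
`0 → A → M → B → 0` of representations. -/
def IsRepExtension {K G A M B : Type*} [CommRing K] [Monoid G]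
    [AddCommGroup A] [Module K A] [AddCommGroup M] [Module K M] [AddCommGroup B] [Module K B]
    (ρA : Representation K G A) (ρM : Representation K G M) (ρB : Representation K G B) : Prop :=
  ∃ (i : Representation.IntertwiningMap ρA ρM) (π : Representation.IntertwiningMap ρM ρB),
    Function.Injective i ∧ Function.Exact i π ∧ Function.Surjective π

theorem summable_zpow_neg_sq {x : ℝ} (hx : 1 < x) : Summable fun r : ℤ => x ^ (-(r ^ 2)) := by
  have hx0 : 0 < x := by linarith
  have key : Summable fun n : ℕ => x ^ (-((n : ℤ) ^ 2)) := by
    refine Summable.of_nonneg_of_le (fun n => by positivity) (fun n => ?_)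
      (summable_geometric_of_lt_one (inv_nonneg.2 hx0.le) (inv_lt_one_of_one_lt₀ hx))
    rw [inv_pow, ← zpow_natCast, ← zpow_neg]
    refine zpow_le_zpow_right₀ hx.le ?_
    have : (n : ℤ) ≤ (n : ℤ) ^ 2 := by
      exact_mod_cast Nat.le_self_pow two_ne_zero n
    omega
  exact Summable.of_nat_of_neg key (by simpa using key)

theorem one_le_thetaSum {x : ℝ} (hx : 1 < x) : 1 ≤ thetaSum x := by
  have hx0 : 0 < x := by linarith
  simpa [thetaSum] using (summable_zpow_neg_sq hx).le_tsum 0 (fun j _ => by positivity)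

theorem thetaSum_anti {x y : ℝ} (hx : 1 < x) (hxy : x ≤ y) : thetaSum y ≤ thetaSum x := by
  refine (summable_zpow_neg_sq (hx.trans_le hxy)).tsum_le_tsum (fun r => ?_)
    (summable_zpow_neg_sq hx)
  have hx0 : 0 < x := by linarith
  rw [zpow_neg, zpow_neg]
  exact inv_anti₀ (by positivity) (zpow_le_zpow_left₀ (sq_nonneg r) hx0.le hxy)

open Complex in
/-- Among all translates, the lattice sum of a Gaussian is largest at the origin. -/
theorem tsum_exp_neg_sq_translate_le {a : ℝ} (ha : 0 < a) (s : ℝ) :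
    ∑' n : ℤ, Real.exp (-Real.pi * a * (n + s) ^ 2) ≤
      ∑' n : ℤ, Real.exp (-Real.pi * a * (n : ℝ) ^ 2) := by
  have hai : (0 : ℝ) < a⁻¹ := inv_pos.2 ha
  have h1 := Complex.tsum_exp_neg_quadratic (a := ((a⁻¹ : ℝ) : ℂ)) (by simpa using ha)
    (-(I * s))
  have h0 := Real.tsum_exp_neg_mul_int_sq hai
  set A : ℝ := a⁻¹ ^ (1 / 2 : ℝ) with hA
  have hApos : 0 < A := by positivity
  have hAc : ((a⁻¹ : ℝ) : ℂ) ^ (1 / 2 : ℂ) = (A : ℂ) := by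
    rw [hA, Complex.ofReal_cpow hai.le]; norm_num
  have e1 : ∀ n : ℤ, cexp (-(Real.pi : ℂ) / ((a⁻¹ : ℝ) : ℂ) * (n + I * -(I * s)) ^ 2) =
      ((Real.exp (-Real.pi * a * (n + s) ^ 2) : ℝ) : ℂ) := by
    intro n
    have : I * -(I * (s : ℂ)) = s := by
      rw [mul_neg, ← mul_assoc, I_mul_I]; ring
    rw [this]
    push_cast
    congr 1
    rw [div_inv_eq_mul]
  simp_rw [e1] at h1
  rw [hAc, ← Complex.ofReal_tsum] at h1
  have e0 : ∀ n : ℤ, Real.exp (-Real.pi / a⁻¹ * (n : ℝ) ^ 2) =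
      Real.exp (-Real.pi * a * (n : ℝ) ^ 2) := fun n => by rw [div_inv_eq_mul]
  simp_rw [e0] at h0
  set T : ℝ := ∑' n : ℤ, Real.exp (-Real.pi * a * (n + s) ^ 2) with hT
  set T0 : ℝ := ∑' n : ℤ, Real.exp (-Real.pi * a * (n : ℝ) ^ 2)
  have hTnn : 0 ≤ T := tsum_nonneg fun n => (Real.exp_pos _).le
  have hnorm : ∀ n : ℤ, ‖cexp (-(Real.pi : ℂ) * ((a⁻¹ : ℝ) : ℂ) * (n : ℂ) ^ 2 +
      2 * Real.pi * -(I * s) * n)‖ = Real.exp (-Real.pi * a⁻¹ * (n : ℝ) ^ 2) := by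
    intro n
    rw [Complex.norm_exp]
    congr 1
    have : (-(Real.pi : ℂ) * ((a⁻¹ : ℝ) : ℂ) * (n : ℂ) ^ 2 + 2 * Real.pi * -(I * s) * n) =
      ((-Real.pi * a⁻¹ * (n : ℝ) ^ 2 : ℝ) : ℂ) + ((-(2 * Real.pi * s * n) : ℝ) : ℂ) * I := by
      push_cast; ring
    rw [this]
    simp only [Complex.add_re, Complex.ofReal_re, Complex.re_ofReal_mul, Complex.I_re]
    ring
  have hsum : Summable fun n : ℤ => Real.exp (-Real.pi * a⁻¹ * (n : ℝ) ^ 2) := by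
    have := ((summable_jacobiTheta₂_term_iff 0 (I * (a⁻¹ : ℝ))).2 (by simpa using ha)).norm
    refine this.congr fun n => ?_
    rw [norm_jacobiTheta₂_term]
    congr 1
    simp
    ring
  have hle : ‖(1 / (A : ℂ)) * (T : ℂ)‖ ≤ 1 / A * T0 := by
    rw [← h1, ← h0]
    refine (norm_tsum_le_tsum_norm (by simpa only [hnorm] using hsum)).trans ?_
    simp_rw [hnorm]; rfl
  rw [norm_mul, Complex.norm_real, norm_div, norm_one, Complex.norm_real, Real.norm_of_nonneg hTnn,
    Real.norm_of_nonneg hApos.le] at hle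
  exact le_of_mul_le_mul_left hle (by positivity)

theorem summable_exp_neg_sq_translate {a : ℝ} (ha : 0 < a) (s : ℝ) :
    Summable fun n : ℤ => Real.exp (-Real.pi * a * (n + s) ^ 2) := by
  have := (((summable_jacobiTheta₂_term_iff (Complex.I * ((a * s : ℝ) : ℂ))
    (Complex.I * (a : ℂ))).2 (by simpa using ha)).norm).mul_left (Real.exp (-Real.pi * a * s ^ 2))
  refine this.congr fun n => ?_
  rw [norm_jacobiTheta₂_term, ← Real.exp_add]
  congr 1
  simp
  ring

theorem sum_pow_mul_sub_le {x : ℝ} (hx : 1 < x) (n : ℕ) :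
    ∑ c ∈ Finset.range (n + 1), x ^ (c * (n - c)) ≤ thetaSum x * x ^ ((n : ℝ) ^ 2 / 4) := by
  have hx0 : 0 < x := by linarith
  have hpi := Real.pi_pos
  set a : ℝ := Real.log x / Real.pi with ha'
  have hlog : Real.log x = Real.pi * a := by rw [ha']; field_simp
  have ha : 0 < a := div_pos (Real.log_pos hx) hpi
  have hth : thetaSum x = ∑' r : ℤ, Real.exp (-Real.pi * a * (r : ℝ) ^ 2) := by
    refine tsum_congr fun r => ?_
    rw [← Real.rpow_intCast, Real.rpow_def_of_pos hx0, hlog]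
    congr 1
    push_cast
    ring
  have hs := (summable_exp_neg_sq_translate ha (-(n : ℝ) / 2)).sum_le_tsum
    ((Finset.range (n + 1)).map ⟨fun k : ℕ => (k : ℤ), Nat.cast_injective⟩)
    (fun _ _ => (Real.exp_pos _).le)
  have h2 := hs.trans (tsum_exp_neg_sq_translate_le ha _)
  rw [← hth, Finset.sum_map] at h2
  refine le_trans (le_of_eq ?_) (mul_le_mul_of_nonneg_right h2 (by positivity))
  rw [Finset.sum_mul]
  refine Finset.sum_congr rfl fun c hc => ?_
  have hcn : c ≤ n := by simpa [Nat.lt_succ_iff] using hc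
  rw [← Real.rpow_natCast, Real.rpow_def_of_pos hx0, Real.rpow_def_of_pos hx0, ← Real.exp_add, hlog]
  congr 1
  push_cast [Nat.cast_sub hcn, Function.Embedding.coeFn_mk]
  ring

theorem multipliable_one_div_one_sub_zpow {x : ℝ} (hx : 1 < x) :
    Multipliable fun j : ℕ => 1 / (1 - x ^ (-((j : ℤ) + 1))) := by
  have hx0 : 0 < x := by linarith
  have hy : ∀ j : ℕ, x ^ (-((j : ℤ) + 1)) ≤ x⁻¹ := fun j => by
    rw [← zpow_neg_one]; exact zpow_le_zpow_right₀ hx.le (by omega)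
  have hi : x⁻¹ < 1 := inv_lt_one_of_one_lt₀ hx
  have hsum : Summable fun j : ℕ => x ^ (-((j : ℤ) + 1)) / (1 - x ^ (-((j : ℤ) + 1))) := by
    refine Summable.of_nonneg_of_le (fun j => ?_) (fun j => ?_)
      ((summable_geometric_of_lt_one (inv_nonneg.2 hx0.le) hi).mul_left (x⁻¹ / (1 - x⁻¹)))
    · exact div_nonneg (by positivity) (by linarith [hy j])
    · have : x ^ (-((j : ℤ) + 1)) = x⁻¹ * x⁻¹ ^ j := by
        rw [zpow_neg, ← pow_succ', inv_pow, ← zpow_natCast]; norm_cast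
      calc _ ≤ x ^ (-((j : ℤ) + 1)) / (1 - x⁻¹) :=
            div_le_div_of_nonneg_left (by positivity) (by linarith) (by linarith [hy j])
        _ = _ := by rw [this]; ring
  refine (Real.multipliable_one_add_of_summable hsum).congr fun j => ?_
  have : 1 - x ^ (-((j : ℤ) + 1)) ≠ 0 := by linarith [hy j]
  field_simp
  ring

theorem one_le_one_div_one_sub_zpow {x : ℝ} (hx : 1 < x) (j : ℕ) :
    1 ≤ 1 / (1 - x ^ (-((j : ℤ) + 1))) := by
  have hx0 : 0 < x := by linarith
  have h1 : x ^ (-((j : ℤ) + 1)) < 1 := zpow_lt_one_of_neg₀ hx (by omega)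
  have h2 : 0 < x ^ (-((j : ℤ) + 1)) := by positivity
  rw [le_div_iff₀ (by linarith)]
  linarith

theorem prod_range_le_eulerProd {x : ℝ} (hx : 1 < x) (w : ℕ) :
    ∏ j ∈ Finset.range w, 1 / (1 - x ^ (-((j : ℤ) + 1))) ≤ eulerProd x := by
  refine Monotone.ge_of_tendsto (monotone_nat_of_le_succ fun n => ?_)
    (multipliable_one_div_one_sub_zpow hx).hasProd.tendsto_prod_nat w
  rw [Finset.prod_range_succ]
  exact le_mul_of_one_le_right
    (Finset.prod_nonneg fun j _ => zero_le_one.trans (one_le_one_div_one_sub_zpow hx j))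
    (one_le_one_div_one_sub_zpow hx n)

theorem one_le_eulerProd {x : ℝ} (hx : 1 < x) : 1 ≤ eulerProd x := by
  simpa using prod_range_le_eulerProd hx 0

/-- The order of `GL(w, q)` is at least `q ^ (w ^ 2) / D(x)` for `1 < x ≤ q`. -/
theorem pow_le_eulerProd_mul_prod {x : ℝ} (hx : 1 < x) {q : ℕ} (hq : x ≤ q) (w : ℕ) :
    (q : ℝ) ^ (w * w) ≤ eulerProd x * ((∏ i ∈ Finset.range w, (q ^ w - q ^ i) : ℕ) : ℝ) := by
  have hx0 : 0 < x := by linarith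
  have hq1 : (1 : ℝ) < q := hx.trans_le hq
  have hq0 : (0 : ℝ) < q := by linarith
  have hpos : ∀ j : ℕ, 0 < 1 - x ^ (-((j : ℤ) + 1)) := fun j =>
    sub_pos.2 (zpow_lt_one_of_neg₀ hx (by omega))
  have hP : 0 < ∏ j ∈ Finset.range w, (1 - x ^ (-((j : ℤ) + 1))) :=
    Finset.prod_pos fun j _ => hpos j
  have hD := prod_range_le_eulerProd hx w
  rw [Finset.prod_div_distrib, Finset.prod_const_one, div_le_iff₀ hP] at hD
  have hD0 : 0 ≤ eulerProd x := zero_le_one.trans (one_le_eulerProd hx)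
  have hE : (q : ℝ) ^ (w * w) * ∏ j ∈ Finset.range w, (1 - x ^ (-((j : ℤ) + 1))) ≤
      ((∏ i ∈ Finset.range w, (q ^ w - q ^ i) : ℕ) : ℝ) := by
    rw [← Finset.prod_range_reflect]
    rw [pow_mul, ← Finset.card_range w, ← Finset.prod_const, Finset.card_range,
      ← Finset.prod_mul_distrib]
    push_cast
    refine Finset.prod_le_prod (fun i _ => mul_nonneg (by positivity) (hpos _).le) fun i hi => ?_
    have hiw : i < w := Finset.mem_range.1 hi
    rw [Nat.cast_sub (Nat.pow_le_pow_right (by exact_mod_cast hq0) hiw.le)]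
    push_cast
    rw [mul_sub, mul_one]
    have h1 : (q : ℝ) ^ (-(((w - 1 - i : ℕ) : ℤ) + 1)) ≤ x ^ (-(((w - 1 - i : ℕ) : ℤ) + 1)) := by
      rw [zpow_neg, zpow_neg]
      exact inv_anti₀ (by positivity) (zpow_le_zpow_left₀ (by omega) hx0.le hq)
    have h2 : (q : ℝ) ^ i = q ^ w * (q : ℝ) ^ (-(((w - 1 - i : ℕ) : ℤ) + 1)) := by
      rw [← zpow_natCast, ← zpow_natCast, ← zpow_add₀ hq0.ne']
      congr 1
      omega
    rw [h2]
    gcongr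
  calc (q : ℝ) ^ (w * w) ≤ (q : ℝ) ^ (w * w) * (eulerProd x *
        ∏ j ∈ Finset.range w, (1 - x ^ (-((j : ℤ) + 1)))) := le_mul_of_one_le_right (by positivity) hD
    _ = eulerProd x * ((q : ℝ) ^ (w * w) *
        ∏ j ∈ Finset.range w, (1 - x ^ (-((j : ℤ) + 1)))) := by ring
    _ ≤ _ := mul_le_mul_of_nonneg_left hE hD0

/-- Each `w`-dimensional subspace has `|GL(w, q)|` ordered bases, all of them `w`-tuples in `U`. -/
theorem card_submodule_finrank_eq_mul_le {F U : Type*} [Field F] [Finite F] [AddCommGroup U]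
    [Module F U] [FiniteDimensional F U] (w : ℕ) :
    Nat.card {W : Submodule F U // Module.finrank F W = w} *
        ∏ i ∈ Finset.range w, (Nat.card F ^ w - Nat.card F ^ i) ≤
      Nat.card F ^ (Module.finrank F U * w) := by
  have := Fintype.ofFinite F
  have : Finite U := Module.finite_of_finite F
  have := Fintype.ofFinite {W : Submodule F U // Module.finrank F W = w}
  let f : (Σ W : {W : Submodule F U // Module.finrank F W = w},
      {s : Fin w → W.1 // LinearIndependent F s}) → (Fin w → U) := fun a i => (a.2.1 i : U)
  have hspan : ∀ a, Submodule.span F (Set.range (f a)) = a.1.1 := by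
    rintro ⟨W, s, hs⟩
    have h1 : Submodule.span F (Set.range s) = ⊤ :=
      hs.span_eq_top_of_card_eq_finrank' (by simp [W.2])
    have h2 : Set.range (f ⟨W, s, hs⟩) = W.1.subtype '' Set.range s := by
      rw [← Set.range_comp]; rfl
    rw [h2, Submodule.span_image, h1, Submodule.map_subtype_top]
  have hf : Function.Injective f := by
    intro a b hab
    have h1 : a.1 = b.1 := Subtype.ext (by rw [← hspan a, ← hspan b, hab])
    obtain ⟨W, s, hs⟩ := a
    obtain ⟨W', s', hs'⟩ := b
    obtain rfl : W = W' := h1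
    congr 2
    funext i
    exact Subtype.ext (congrFun hab i)
  have hcard := Nat.card_le_card_of_injective f hf
  rw [Nat.card_sigma, Nat.card_fun, Nat.card_fin, Module.natCard_eq_pow_finrank (K := F),
    ← pow_mul] at hcard
  refine le_trans (le_of_eq ?_) hcard
  rw [Finset.sum_congr rfl (g := fun _ => ∏ i ∈ Finset.range w, (Nat.card F ^ w - Nat.card F ^ i))]
  · simp [Nat.card_eq_fintype_card]
  · intro W _
    rw [card_linearIndependent (K := F) (V := W.1) (by rw [W.2]), W.2, Finset.prod_range]
    simp [Nat.card_eq_fintype_card]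

/-- The Gaussian binomial coefficient `[n, w]_q` is at most `D(x) q ^ (w (n - w))`. -/
theorem card_submodule_finrank_eq_le {F U : Type*} [Field F] [Finite F] [AddCommGroup U]
    [Module F U] [FiniteDimensional F U] {x : ℝ} (hx : 1 < x) (hq : x ≤ Nat.card F) (w : ℕ) :
    (Nat.card {W : Submodule F U // Module.finrank F W = w} : ℝ) ≤
      eulerProd x * (Nat.card F : ℝ) ^ (w * (Module.finrank F U - w)) := by
  have hq1 : (1 : ℝ) < Nat.card F := hx.trans_le hq
  have hq0 : (0 : ℝ) < Nat.card F := by linarith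
  have hD0 : 1 ≤ eulerProd x := one_le_eulerProd hx
  have : Finite U := Module.finite_of_finite F
  rcases lt_or_ge (Module.finrank F U) w with h | hw
  · have : IsEmpty {W : Submodule F U // Module.finrank F W = w} :=
      ⟨fun W => by have := Submodule.finrank_le W.1; have := W.2; omega⟩
    rw [Nat.card_of_isEmpty]
    push_cast
    positivity
  have h1 := card_submodule_finrank_eq_mul_le (F := F) (U := U) w
  have h2 := pow_le_eulerProd_mul_prod hx hq w
  set N := Nat.card {W : Submodule F U // Module.finrank F W = w}
  set P := ∏ i ∈ Finset.range w, (Nat.card F ^ w - Nat.card F ^ i)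
  set q := Nat.card F
  have h3 : (N : ℝ) * P ≤ (q : ℝ) ^ (Module.finrank F U * w) := by exact_mod_cast h1
  have h4 : (N : ℝ) * (q : ℝ) ^ (w * w) ≤
      eulerProd x * (q : ℝ) ^ (w * (Module.finrank F U - w)) * (q : ℝ) ^ (w * w) := by
    rw [mul_assoc, ← pow_add, ← mul_add, Nat.sub_add_cancel hw, mul_comm w (Module.finrank F U)]
    calc (N : ℝ) * (q : ℝ) ^ (w * w) ≤ N * (eulerProd x * P) := by gcongr
      _ = eulerProd x * (N * P) := by ring
      _ ≤ _ := by gcongr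
  exact le_of_mul_le_mul_right h4 (by positivity)

theorem card_submodule_eq_sum {F U : Type*} [Field F] [Finite F] [AddCommGroup U]
    [Module F U] [FiniteDimensional F U] (P : Submodule F U → Prop) :
    Nat.card {W : Submodule F U // P W} = ∑ w ∈ Finset.range (Module.finrank F U + 1),
      Nat.card {W : Submodule F U // P W ∧ Module.finrank F W = w} := by
  classical
  have : Finite U := Module.finite_of_finite F
  have := Fintype.ofFinite (Submodule F U)
  simp only [Nat.card_eq_fintype_card, Fintype.card_subtype]
  rw [Finset.card_eq_sum_card_fiberwise (f := fun W : Submodule F U => Module.finrank F W)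
    (t := Finset.range (Module.finrank F U + 1))]
  · simp only [Finset.filter_filter]
  · intro W _
    simpa [Nat.lt_succ_iff] using Submodule.finrank_le W

/-- The number of subspaces of a space of dimension `n` over a field with `q` elements is at most
`C(x) D(x) q ^ (n ^ 2 / 4)` for `1 < x ≤ q`. -/
theorem card_submodule_le {F U : Type*} [Field F] [Finite F] [AddCommGroup U]
    [Module F U] [FiniteDimensional F U] {x : ℝ} (hx : 1 < x) (hq : x ≤ Nat.card F) :
    (Nat.card (Submodule F U) : ℝ) ≤ thetaSum x * eulerProd x *
      (Nat.card F : ℝ) ^ ((Module.finrank F U : ℝ) ^ 2 / 4) := by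
  have hD0 : 1 ≤ eulerProd x := one_le_eulerProd hx
  have h := card_submodule_eq_sum (F := F) (U := U) fun _ => True
  rw [Nat.card_congr (Equiv.subtypeUnivEquiv fun _ => trivial)] at h
  simp only [true_and] at h
  rw [h]
  push_cast
  calc _ ≤ ∑ w ∈ Finset.range (Module.finrank F U + 1),
        eulerProd x * (Nat.card F : ℝ) ^ (w * (Module.finrank F U - w)) :=
        Finset.sum_le_sum fun w _ => card_submodule_finrank_eq_le hx hq w
    _ ≤ eulerProd x * (thetaSum (Nat.card F) *
        (Nat.card F : ℝ) ^ ((Module.finrank F U : ℝ) ^ 2 / 4)) := by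
        rw [← Finset.mul_sum]
        gcongr
        exact sum_pow_mul_sub_le (hx.trans_le hq) _
    _ ≤ eulerProd x * (thetaSum x *
        (Nat.card F : ℝ) ^ ((Module.finrank F U : ℝ) ^ 2 / 4)) := by
        gcongr
        exact thetaSum_anti hx hq
    _ = _ := by ring

/-- Subspaces between `E` and `K` of given dimension `c`. -/
theorem card_submodule_between_le {F U : Type*} [Field F] [Finite F] [AddCommGroup U]
    [Module F U] [FiniteDimensional F U] {x : ℝ} (hx : 1 < x) (hq : x ≤ Nat.card F)
    {E K : Submodule F U} (hEK : E ≤ K) (c : ℕ) :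
    (Nat.card {W : Submodule F U // (E ≤ W ∧ W ≤ K) ∧ Module.finrank F W = c} : ℝ) ≤
      eulerProd x * (Nat.card F : ℝ) ^
        ((c - Module.finrank F E) * (Module.finrank F K - c)) := by
  have : Finite U := Module.finite_of_finite F
  set E' : Submodule F K := E.comap K.subtype
  have hE' : Module.finrank F E' = Module.finrank F E :=
    (Submodule.comapSubtypeEquivOfLe hEK).finrank_eq
  let f : {W : Submodule F U // (E ≤ W ∧ W ≤ K) ∧ Module.finrank F W = c} →
      {Y : Submodule F (K ⧸ E') // Module.finrank F Y = c - Module.finrank F E} := fun W =>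
    ⟨(W.1.comap K.subtype).map E'.mkQ, by
      have h1 := LinearMap.finrank_range_add_finrank_ker
        (E'.mkQ.domRestrict (W.1.comap K.subtype))
      have h2 : Module.finrank F (W.1.comap K.subtype) = c := by
        rw [(Submodule.comapSubtypeEquivOfLe W.2.1.2).finrank_eq, W.2.2]
      have h3 : Module.finrank F (LinearMap.ker (E'.mkQ.domRestrict (W.1.comap K.subtype))) =
          Module.finrank F E := by
        rw [LinearMap.ker_domRestrict, Submodule.ker_mkQ, ← hE']
        exact (Submodule.comapSubtypeEquivOfLe (Submodule.comap_mono W.2.1.1)).finrank_eq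
      rw [LinearMap.range_domRestrict] at h1
      omega⟩
  have hf : Function.Injective f := by
    intro W W' h
    have h1 : (W.1.comap K.subtype).map E'.mkQ = (W'.1.comap K.subtype).map E'.mkQ :=
      congrArg Subtype.val h
    have h2 := congrArg (Submodule.comap E'.mkQ) h1
    rw [Submodule.comap_map_mkQ, Submodule.comap_map_mkQ,
      sup_eq_right.2 (Submodule.comap_mono W.2.1.1),
      sup_eq_right.2 (Submodule.comap_mono W'.2.1.1)] at h2
    have h3 := congrArg (Submodule.map K.subtype) h2
    rw [Submodule.map_comap_subtype, Submodule.map_comap_subtype, inf_eq_right.2 W.2.1.2,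
      inf_eq_right.2 W'.2.1.2] at h3
    exact Subtype.ext h3
  have : Finite (K ⧸ E') := Module.finite_of_finite F
  have hcard : (Nat.card {W : Submodule F U // (E ≤ W ∧ W ≤ K) ∧ Module.finrank F W = c} : ℝ) ≤
      _ := Nat.cast_le.2 (Nat.card_le_card_of_injective f hf)
  refine hcard.trans ((card_submodule_finrank_eq_le hx hq _).trans ?_)
  have hquot := Submodule.finrank_quotient_add_finrank E'
  refine le_of_eq ?_
  congr 2
  rcases le_total c (Module.finrank F E) with h | h
  · simp [Nat.sub_eq_zero_of_le h]
  · congr 1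
    omega

theorem exists_fin_sup_span_eq {F U : Type*} [Field F] [AddCommGroup U]
    [Module F U] [FiniteDimensional F U] {A B : Submodule F U} (hAB : A ≤ B) {t : ℕ}
    (ht : Module.finrank F B ≤ Module.finrank F A + t) :
    ∃ b : Fin t → U, (∀ i, b i ∈ B) ∧ A ⊔ Submodule.span F (Set.range b) = B := by
  set A' : Submodule F B := A.comap B.subtype
  have hA' : Module.finrank F A' = Module.finrank F A :=
    (Submodule.comapSubtypeEquivOfLe hAB).finrank_eq
  obtain ⟨C, hC⟩ := Submodule.exists_isCompl A'
  have hdim := Submodule.finrank_add_eq_of_isCompl hC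
  have hCt : Module.finrank F C ≤ t := by omega
  let e := Module.finBasis F C
  let b : Fin t → U := fun i => if h : i.1 < Module.finrank F C then ((e ⟨i, h⟩ : C) : B) else 0
  have hmem : ∀ i, b i ∈ B := fun i => by
    simp only [b]; split_ifs
    · exact Subtype.coe_prop _
    · exact zero_mem _
  refine ⟨b, hmem, le_antisymm (sup_le hAB (Submodule.span_le.2 ?_)) ?_⟩
  · rintro _ ⟨i, rfl⟩; exact hmem i
  · have h1 : C.map B.subtype ≤ Submodule.span F (Set.range b) := by
      rw [← Submodule.map_subtype_top C, ← e.span_eq, ← Submodule.map_comp, ← Submodule.span_image]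
      refine Submodule.span_mono ?_
      rintro _ ⟨_, ⟨i, rfl⟩, rfl⟩
      refine ⟨⟨i, i.2.trans_le hCt⟩, ?_⟩
      simp [b]
    have h2 : A'.map B.subtype ≤ A := Submodule.map_comap_le _ _
    calc B = (A' ⊔ C).map B.subtype := by rw [hC.sup_eq_top, Submodule.map_subtype_top]
      _ ≤ _ := by rw [Submodule.map_sup]; exact sup_le_sup h2 h1

/-- The number of submodules `W` stable under `N` with given image `N W` and given intersection
with the kernel of `N`. -/
theorem card_stable_fiber_mul_le {F M : Type*} [Field F] [Finite F] [AddCommGroup M]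
    [Module F M] [FiniteDimensional F M] (N : M →ₗ[F] M) (B K' : Submodule F M)
    (hB : B ≤ LinearMap.range N) (hK' : K' ≤ LinearMap.ker N) :
    Nat.card {W : Submodule F M // W.map N ≤ W ∧ W.map N = B ∧ W ⊓ LinearMap.ker N = K'} *
        Nat.card F ^ (Module.finrank F K' * Module.finrank F ↥(B ⊓ LinearMap.ker N)) ≤
      Nat.card F ^ (Module.finrank F (LinearMap.ker N) *
        Module.finrank F ↥(B ⊓ LinearMap.ker N)) := by
  have : Finite M := Module.finite_of_finite F
  set e := Module.finrank F ↥(B ⊓ LinearMap.ker N)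
  set S := {W : Submodule F M // W.map N ≤ W ∧ W.map N = B ∧ W ⊓ LinearMap.ker N = K'}
  by_cases hS : IsEmpty S
  · simp
  rw [not_isEmpty_iff] at hS
  obtain ⟨W₀, hW₀, hW₀B, hW₀K⟩ := hS
  have hNB : B.map N ≤ B := by
    have := Submodule.map_mono (f := N) (hW₀B ▸ hW₀)
    rwa [hW₀B] at this
  have hdim : Module.finrank F B ≤ Module.finrank F (B.map N) + e := by
    have h1 := LinearMap.finrank_range_add_finrank_ker (N.domRestrict B)
    rw [LinearMap.range_domRestrict, LinearMap.ker_domRestrict] at h1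
    have h2 : Module.finrank F ((LinearMap.ker N).comap B.subtype) = e := by
      have : ((LinearMap.ker N).comap B.subtype).map B.subtype = B ⊓ LinearMap.ker N :=
        Submodule.map_comap_subtype _ _
      rw [← Submodule.finrank_map_subtype_eq, this]
    rw [h2] at h1
    exact h1.ge
  obtain ⟨b, hb, hspan⟩ := exists_fin_sup_span_eq hNB hdim
  choose y hy using fun i => hB (hb i)
  have hlift : ∀ W : S, ∀ i, ∃ z ∈ W.1, N z = b i := fun W i => by
    have := hb i
    rw [← W.2.2.1] at this
    exact this
  choose z hz hNz using hlift
  have hK'W : ∀ W : S, K' ≤ W.1 := fun W => W.2.2.2.ge.trans inf_le_left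
  have hgen : ∀ (W : S) (u : Fin e → M), (∀ i, u i ∈ W.1) → (∀ i, N (u i) = b i) →
      W.1 = K' ⊔ B ⊔ Submodule.span F (Set.range u) := by
    intro W u hu hNu
    have hle : K' ⊔ B ⊔ Submodule.span F (Set.range u) ≤ W.1 := by
      refine sup_le (sup_le ?_ ?_) (Submodule.span_le.2 ?_)
      · exact hK'W W
      · have := W.2.1
        rwa [W.2.2.1] at this
      · rintro _ ⟨i, rfl⟩; exact hu i
    refine le_antisymm ?_ hle
    intro w hw
    have h1 : N w ∈ (B ⊔ Submodule.span F (Set.range u)).map N := by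
      rw [Submodule.map_sup, Submodule.map_span, ← Set.range_comp]
      have : (N ∘ u) = b := funext hNu
      rw [this, hspan, ← W.2.2.1]
      exact Submodule.mem_map_of_mem hw
    obtain ⟨w', hw', hww'⟩ := h1
    have h2 : w - w' ∈ K' := by
      rw [← W.2.2.2]
      refine ⟨W.1.sub_mem hw 
        (hle (sup_le_sup_right (le_sup_right : B ≤ K' ⊔ B) (Submodule.span F (Set.range u)) hw')), ?_⟩
      · simp [hww']
    have h3 : w = (w - w') + w' := by abel
    rw [h3, sup_assoc]
    exact Submodule.add_mem_sup h2 hw'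
  let f : S × (Fin e → K') → (Fin e → LinearMap.ker N) := fun a i =>
    ⟨z a.1 i - y i + a.2 i, by
      have := hK' (a.2 i).2
      rw [LinearMap.mem_ker] at this ⊢
      rw [map_add, map_sub, hNz, hy, this]; simp⟩
  have hf : Function.Injective f := by
    rintro ⟨W, k⟩ ⟨W', k'⟩ h
    have h1 : ∀ i, z W i + k i = z W' i + k' i := fun i => by
      have := congrArg Subtype.val (congrFun h i)
      simp only [f] at this
      have h2 := congrArg (· + y i) this
      calc z W i + k i = z W i - y i + k i + y i := by abel
        _ = z W' i - y i + k' i + y i := h2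
        _ = _ := by abel
    have hmem : ∀ (W : S) (k : Fin e → K'), ∀ i, z W i + k i ∈ W.1 := fun W k i =>
      W.1.add_mem (hz W i) (hK'W W (k i).2)
    have hN : ∀ (W : S) (k : Fin e → K'), ∀ i, N (z W i + k i) = b i := fun W k i => by
      have := hK' (k i).2
      rw [LinearMap.mem_ker] at this
      rw [map_add, hNz, this, add_zero]
    have h2 : W = W' := Subtype.ext <| by
      rw [hgen W _ (hmem W k) (hN W k), hgen W' _ (hmem W' k') (hN W' k')]
      simp only [h1]
    subst h2
    have : k = k' := funext fun i => Subtype.ext (add_left_cancel (h1 i))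
    rw [this]
  have hcard := Nat.card_le_card_of_injective f hf
  rwa [Nat.card_prod, Nat.card_fun, Nat.card_fun, Nat.card_fin,
    Module.natCard_eq_pow_finrank (K := F) (V := LinearMap.ker N),
    Module.natCard_eq_pow_finrank (K := F) (V := K'),
    ← pow_mul, ← pow_mul, mul_comm (Module.finrank F K'), mul_comm (Module.finrank F _)] at hcard

theorem card_stable_image_le {F M : Type*} [Field F] [Finite F] [AddCommGroup M]
    [Module F M] [FiniteDimensional F M] {x : ℝ} (hx : 1 < x) (hq : x ≤ Nat.card F)
    (N : M →ₗ[F] M) (B : Submodule F M) (hB : B ≤ LinearMap.range N) :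
    (Nat.card {W : Submodule F M // W.map N ≤ W ∧ W.map N = B} : ℝ) ≤
      thetaSum x * eulerProd x *
        (Nat.card F : ℝ) ^ ((Module.finrank F (LinearMap.ker N) : ℝ) ^ 2 / 4) := by
  classical
  have : Finite M := Module.finite_of_finite F
  have := Fintype.ofFinite (Submodule F M)
  set K := LinearMap.ker N with hK
  set E := B ⊓ K with hE
  set n := Module.finrank F K with hn
  set e := Module.finrank F E with he
  have hq1 : (1 : ℝ) < Nat.card F := hx.trans_le hq
  have hq0 : (0 : ℝ) < Nat.card F := by linarith
  have hD0 : 1 ≤ eulerProd x := one_le_eulerProd hx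
  have hfiber : ∀ K' : Submodule F M, K' ≤ K →
      (Nat.card {W : Submodule F M // W.map N ≤ W ∧ W.map N = B ∧ W ⊓ K = K'} : ℝ) ≤
        (Nat.card F : ℝ) ^ (e * (n - Module.finrank F K')) := by
    intro K' hK'
    have h := card_stable_fiber_mul_le N B K' hB hK'
    have hle : Module.finrank F K' ≤ n := Submodule.finrank_mono hK'
    have h' : (Nat.card {W : Submodule F M // W.map N ≤ W ∧ W.map N = B ∧ W ⊓ K = K'} : ℝ) *
        (Nat.card F : ℝ) ^ (e * Module.finrank F K') ≤ (Nat.card F : ℝ) ^ (e * n) := by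
      rw [mul_comm e, mul_comm e]
      exact_mod_cast h
    have hsplit : e * n = e * (n - Module.finrank F K') + e * Module.finrank F K' := by
      rw [← mul_add, Nat.sub_add_cancel hle]
    rw [hsplit, pow_add] at h'
    exact le_of_mul_le_mul_right h' (by positivity)
  have hsum : (Nat.card {W : Submodule F M // W.map N ≤ W ∧ W.map N = B} : ℝ) ≤
      ∑ K' ∈ Finset.univ.filter (fun K' : Submodule F M => E ≤ K' ∧ K' ≤ K),
        (Nat.card F : ℝ) ^ (e * (n - Module.finrank F K')) := by
    rw [Nat.card_eq_fintype_card, Fintype.card_subtype,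
      Finset.card_eq_sum_card_fiberwise (f := fun W : Submodule F M => W ⊓ K)
        (t := Finset.univ.filter (fun K' : Submodule F M => E ≤ K' ∧ K' ≤ K))]
    · push_cast
      refine Finset.sum_le_sum fun K' hK' => ?_
      have := hfiber K' (Finset.mem_filter.1 hK').2.2
      rw [Nat.card_eq_fintype_card, Fintype.card_subtype] at this
      rw [Finset.filter_filter]
      simpa only [and_assoc] using this
    · intro W hW
      simp only [Finset.coe_filter, Finset.mem_univ, true_and, Set.mem_ofPred_eq] at hW ⊢
      refine ⟨le_inf (inf_le_left.trans ?_) inf_le_right, inf_le_right⟩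
      rw [← hW.2]; exact hW.1
  refine hsum.trans ?_
  rw [← Finset.sum_fiberwise_of_maps_to (g := fun K' : Submodule F M => Module.finrank F K')
    (t := Finset.range (n + 1))]
  swap
  · intro K' hK'
    have := Submodule.finrank_mono (Finset.mem_filter.1 hK').2.2
    simpa [Nat.lt_succ_iff] using this
  have hterm : ∀ c ∈ Finset.range (n + 1),
      ∑ K' ∈ (Finset.univ.filter (fun K' : Submodule F M => E ≤ K' ∧ K' ≤ K)).filter
        (fun K' : Submodule F M => Module.finrank F K' = c), (Nat.card F : ℝ) ^ (e * (n - Module.finrank F K')) ≤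
      eulerProd x * (Nat.card F : ℝ) ^ (c * (n - c)) := by
    intro c hc
    rcases lt_or_ge c e with hce | hce
    · rw [Finset.sum_eq_zero]
      · positivity
      · intro K' hK'
        simp only [Finset.mem_filter] at hK'
        have := Submodule.finrank_mono hK'.1.2.1
        omega
    · rw [Finset.sum_congr rfl (g := fun _ => (Nat.card F : ℝ) ^ (e * (n - c)))
        (fun K' hK' => by rw [(Finset.mem_filter.1 hK').2]), Finset.sum_const, nsmul_eq_mul]
      have h1 := card_submodule_between_le hx hq (E := E) (K := K) inf_le_right c
      rw [Nat.card_eq_fintype_card, Fintype.card_subtype] at h1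
      rw [Finset.filter_filter]
      calc _ ≤ eulerProd x * (Nat.card F : ℝ) ^ ((c - e) * (n - c)) *
            (Nat.card F : ℝ) ^ (e * (n - c)) := by gcongr
        _ = _ := by rw [mul_assoc, ← pow_add, ← add_mul, Nat.sub_add_cancel hce]
  refine (Finset.sum_le_sum hterm).trans ?_
  rw [← Finset.mul_sum, mul_comm (thetaSum x), mul_assoc]
  refine mul_le_mul_of_nonneg_left ((sum_pow_mul_sub_le hq1 n).trans ?_) (by linarith)
  gcongr
  exact thetaSum_anti hx hq

/-- An endomorphism with kernel of dimension `n` and image of dimension `k` has at most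
`(C D) ^ 2 q ^ ((n ^ 2 + k ^ 2) / 4)` stable subspaces. -/
theorem card_stable_le {F M : Type*} [Field F] [Finite F] [AddCommGroup M]
    [Module F M] [FiniteDimensional F M] {x : ℝ} (hx : 1 < x) (hq : x ≤ Nat.card F)
    (N : M →ₗ[F] M) :
    (Nat.card {W : Submodule F M // W.map N ≤ W} : ℝ) ≤
      (thetaSum x * eulerProd x) ^ 2 *
        (Nat.card F : ℝ) ^ (((Module.finrank F (LinearMap.ker N) : ℝ) ^ 2 +
          (Module.finrank F (LinearMap.range N) : ℝ) ^ 2) / 4) := by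
  classical
  have : Finite M := Module.finite_of_finite F
  have := Fintype.ofFinite (Submodule F M)
  have hq1 : (1 : ℝ) < Nat.card F := hx.trans_le hq
  have hq0 : (0 : ℝ) < Nat.card F := by linarith
  have hC0 := one_le_thetaSum hx
  have hD0 := one_le_eulerProd hx
  rw [Nat.card_eq_fintype_card, Fintype.card_subtype,
    Finset.card_eq_sum_card_fiberwise (f := fun W : Submodule F M => W.map N)
      (t := Finset.univ.filter (fun B : Submodule F M => B ≤ LinearMap.range N))]
  swap
  · intro W _
    simpa using LinearMap.map_le_range
  push_cast
  have hterm : ∀ B ∈ Finset.univ.filter (fun B : Submodule F M => B ≤ LinearMap.range N),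
      (((Finset.univ.filter (fun W : Submodule F M => W.map N ≤ W)).filter
        (fun W => W.map N = B)).card : ℝ) ≤ thetaSum x * eulerProd x *
        (Nat.card F : ℝ) ^ ((Module.finrank F (LinearMap.ker N) : ℝ) ^ 2 / 4) := by
    intro B hB
    have := card_stable_image_le hx hq N B (Finset.mem_filter.1 hB).2
    rw [Nat.card_eq_fintype_card, Fintype.card_subtype] at this
    rwa [Finset.filter_filter]
  refine (Finset.sum_le_sum hterm).trans ?_
  rw [Finset.sum_const, nsmul_eq_mul]
  have hcard : ((Finset.univ.filter
      (fun B : Submodule F M => B ≤ LinearMap.range N)).card : ℝ) ≤ thetaSum x * eulerProd x *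
      (Nat.card F : ℝ) ^ ((Module.finrank F (LinearMap.range N) : ℝ) ^ 2 / 4) := by
    rw [← Fintype.card_subtype, ← Nat.card_eq_fintype_card]
    have := Nat.card_congr (Submodule.mapIic (LinearMap.range N)).toEquiv
    change Nat.card _ = Nat.card {B // B ≤ LinearMap.range N} at this
    rw [← this]
    exact card_submodule_le hx hq
  rw [add_div, Real.rpow_add hq0]
  calc _ ≤ _ := mul_le_mul_of_nonneg_right hcard (by positivity)
    _ = _ := by ring

open Polynomial in
theorem aeval_comp_eq_comp_aeval {F M K : Type*} [Field F] [AddCommGroup M] [Module F M]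
    [AddCommGroup K] [Module F K] {f : M →ₗ[F] M} {h : K →ₗ[F] K} {i : K →ₗ[F] M}
    (hi : i ∘ₗ h = f ∘ₗ i) (r : F[X]) :
    i ∘ₗ (aeval h r : Module.End F K) = (aeval f r : Module.End F M) ∘ₗ i := by
  have hi' : ∀ y, i (h y) = f (i y) := fun y => LinearMap.congr_fun hi y
  induction r using Polynomial.induction_on' with
  | add a b ha hb => rw [map_add, map_add, LinearMap.comp_add, ha, hb, LinearMap.add_comp]
  | monomial n a =>
    have : ∀ n : ℕ, ∀ y, i ((h ^ n) y) = (f ^ n) (i y) := by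
      intro n
      induction n with
      | zero => simp
      | succ n ih => intro y; rw [pow_succ, pow_succ, Module.End.mul_apply, ih, hi']; rfl
    ext y
    simp [aeval_monomial, this, Module.algebraMap_end_apply]

open Polynomial in
theorem map_aeval_le {F M : Type*} [Field F] [AddCommGroup M] [Module F M] {f : M →ₗ[F] M}
    {W : Submodule F M} (hW : W.map f ≤ W) (r : F[X]) : W.map (aeval f r : Module.End F M) ≤ W := by
  have hf : ∀ x ∈ W, f x ∈ W := fun x hx => hW (Submodule.mem_map_of_mem hx)
  have h := aeval_comp_eq_comp_aeval (f := f) (h := f.restrict hf) (i := W.subtype) rfl r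
  rintro _ ⟨y, hy, rfl⟩
  have := LinearMap.congr_fun h ⟨y, hy⟩
  simp only [LinearMap.comp_apply, Submodule.subtype_apply] at this
  rw [← this]
  exact Subtype.coe_prop _

theorem finrank_ker_mul_le {F M : Type*} [Field F] [AddCommGroup M] [Module F M]
    [FiniteDimensional F M] (A B : Module.End F M) :
    Module.finrank F (LinearMap.ker (A * B)) ≤
      Module.finrank F (LinearMap.ker A) + Module.finrank F (LinearMap.ker B) := by
  set K := LinearMap.ker (A * B)
  have h1 := LinearMap.finrank_range_add_finrank_ker (B.domRestrict K)
  have h2 : Module.finrank F (LinearMap.range (B.domRestrict K)) ≤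
      Module.finrank F (LinearMap.ker A) := by
    refine Submodule.finrank_mono ?_
    rintro _ ⟨y, rfl⟩
    exact y.2
  have h3 : Module.finrank F (LinearMap.ker (B.domRestrict K)) ≤
      Module.finrank F (LinearMap.ker B) := by
    rw [LinearMap.ker_domRestrict, ← Submodule.finrank_map_subtype_eq]
    exact Submodule.finrank_mono (Submodule.map_comap_le _ _)
  omega

open Polynomial in
/-- If the kernels of all irreducible polynomials in `f` are small, then multiplying irreducible
factors one by one yields a polynomial whose kernel is neither small nor very large. -/
theorem exists_finrank_ker_aeval_mem_Icc {F M : Type*} [Field F] [AddCommGroup M] [Module F M]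
    [FiniteDimensional F M] (f : Module.End F M) {t : ℕ}
    (hirr : ∀ q : F[X], Irreducible q → Module.finrank F (LinearMap.ker (aeval f q)) ≤ t)
    (ht : t < Module.finrank F M) :
    ∃ s : F[X], t < Module.finrank F (LinearMap.ker (aeval f s)) ∧
      Module.finrank F (LinearMap.ker (aeval f s)) ≤ t + t := by
  by_contra hcon
  push Not at hcon
  have key : ∀ r : F[X], r ≠ 0 → Module.finrank F (LinearMap.ker (aeval f r)) ≤ t := by
    intro r
    induction r using WfDvdMonoid.induction_on_irreducible with
    | zero => intro h; exact absurd rfl h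
    | unit u hu =>
      intro _
      have : IsUnit (aeval f u) := hu.map (aeval f)
      rw [LinearMap.ker_eq_bot.2 ((Module.End.isUnit_iff _).1 this).injective, finrank_bot]
      exact Nat.zero_le _
    | mul a i ha hi ih =>
      intro _
      have h1 := finrank_ker_mul_le (aeval f i) (aeval f a)
      rw [← map_mul] at h1
      have h2 := hirr i hi
      have h3 := ih ha
      by_contra h4
      have := hcon (i * a) (by omega)
      omega
  have h := key f.charpoly f.charpoly_monic.ne_zero
  rw [LinearMap.aeval_self_charpoly, LinearMap.ker_zero, finrank_top] at h
  omega

open Polynomial in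
/-- If `f` is annihilated by an irreducible polynomial of degree at least two, the stable subspaces
are subspaces over a proper extension field, and there are few of them. -/
theorem card_stable_of_aeval_eq_zero_le {F K : Type*} [Field F] [Finite F] [AddCommGroup K]
    [Module F K] [FiniteDimensional F K] {x : ℝ} (hx : 1 < x) (hq : x ≤ Nat.card F)
    (f : Module.End F K) {r : F[X]} (hr : Irreducible r) (hdeg : 2 ≤ r.natDegree)
    (hfr : aeval f r = 0) :
    (Nat.card {W : Submodule F K // W.map f ≤ W} : ℝ) ≤ thetaSum x * eulerProd x *
      (Nat.card F : ℝ) ^ ((Module.finrank F K : ℝ) ^ 2 / 8) := by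
  have : Fact (Irreducible r) := ⟨hr⟩
  have : Finite K := Module.finite_of_finite F
  let E := AdjoinRoot r
  let φ : E →+* Module.End F K := Ideal.Quotient.lift (Ideal.span {r}) (aeval f).toRingHom (by
    intro a ha
    obtain ⟨b, rfl⟩ := Ideal.mem_span_singleton'.1 ha
    change aeval f (b * r) = 0
    rw [map_mul, hfr, mul_zero])
  have hφ : ∀ a : F[X], φ (AdjoinRoot.mk r a) = aeval f a := fun a => rfl
  let _ : Module E K := Module.compHom K φ
  have hsmul : ∀ (a : F[X]) (y : K), (AdjoinRoot.mk r a : E) • y = aeval f a y := fun a y => rfl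
  have : Module.Finite F E := (AdjoinRoot.powerBasis hr.ne_zero).finite
  have : Finite E := Module.finite_of_finite F
  have : Module.Finite E K := Module.Finite.of_finite
  have hE : Nat.card E = Nat.card F ^ r.natDegree := by
    rw [Module.natCard_eq_pow_finrank (K := F) (V := E),
      (AdjoinRoot.powerBasis hr.ne_zero).finrank, AdjoinRoot.powerBasis_dim]
  have hq1 : (1 : ℝ) < Nat.card F := hx.trans_le hq
  have hq1' : 1 < Nat.card F := by exact_mod_cast hq1
  have hdim : Module.finrank F K = r.natDegree * Module.finrank E K := by
    have h1 := Module.natCard_eq_pow_finrank (K := F) (V := K)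
    rw [Module.natCard_eq_pow_finrank (K := E) (V := K), hE, ← pow_mul] at h1
    exact (Nat.pow_right_injective hq1' h1).symm
  let j : {W : Submodule F K // W.map f ≤ W} → Submodule E K := fun W =>
    { carrier := W.1
      add_mem' := W.1.add_mem
      zero_mem' := W.1.zero_mem
      smul_mem' := by
        intro c y hy
        obtain ⟨a, rfl⟩ := AdjoinRoot.mk_surjective c
        rw [hsmul]
        exact map_aeval_le W.2 a (Submodule.mem_map_of_mem hy) }
  have hj : Function.Injective j := fun W W' h => by
    refine Subtype.ext (SetLike.ext fun y => ?_)
    exact SetLike.ext_iff.1 h y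
  have hcard : (Nat.card {W : Submodule F K // W.map f ≤ W} : ℝ) ≤ Nat.card (Submodule E K) :=
    Nat.cast_le.2 (Nat.card_le_card_of_injective j hj)
  have hxE : x ≤ Nat.card E := by
    rw [hE]
    push_cast
    exact hq.trans (le_self_pow₀ hq1.le (by omega))
  have hC0 := one_le_thetaSum hx
  have hD0 := one_le_eulerProd hx
  refine hcard.trans ((card_submodule_le hx hxE).trans ?_)
  refine mul_le_mul_of_nonneg_left ?_ (by positivity)
  rw [hE, hdim]
  push_cast
  rw [← Real.rpow_natCast, ← Real.rpow_mul (by positivity)]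
  refine Real.rpow_le_rpow_of_exponent_le hq1.le ?_
  have hd : (2 : ℝ) ≤ r.natDegree := by exact_mod_cast hdeg
  have hs : (0 : ℝ) ≤ (Module.finrank E K : ℝ) ^ 2 := by positivity
  nlinarith [mul_nonneg (mul_nonneg (sub_nonneg.2 hd) hs) (by positivity : (0:ℝ) ≤ r.natDegree)]

open Polynomial in
theorem card_stable_of_finrank_le {F M : Type*} [Field F] [Finite F] [AddCommGroup M]
    [Module F M] [FiniteDimensional F M] {x : ℝ} (hx : 1 < x) (hq : x ≤ Nat.card F)
    (f : Module.End F M) {r : F[X]} (hr : Irreducible r) (hdeg : 2 ≤ r.natDegree) {t : ℕ}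
    (hker : Module.finrank F M ≤ Module.finrank F (LinearMap.ker (aeval f r)) + t) :
    (Nat.card {W : Submodule F M // W.map f ≤ W} : ℝ) ≤ thetaSum x * eulerProd x *
      (Nat.card F : ℝ) ^ ((Module.finrank F M : ℝ) ^ 2 / 8 + Module.finrank F M * t) := by
  have : Finite M := Module.finite_of_finite F
  set K := LinearMap.ker (aeval f r) with hK
  have hcomm : aeval f r * f = f * aeval f r := by
    have h := Commute.all r X
    have := h.map (aeval f)
    rwa [aeval_X] at this
  have hfK : ∀ y ∈ K, f y ∈ K := fun y hy => by
    rw [hK, LinearMap.mem_ker] at hy ⊢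
    rw [← Module.End.mul_apply, hcomm, Module.End.mul_apply, hy, map_zero]
  let fK : Module.End F K := f.restrict hfK
  have hfKr : aeval fK r = 0 := by
    have h := aeval_comp_eq_comp_aeval (f := f) (h := fK) (i := K.subtype) rfl r
    ext y
    exact (LinearMap.congr_fun h y).trans y.2
  have hex : ∀ W : {W : Submodule F M // W.map f ≤ W}, ∃ b : Fin t → M,
      (∀ i, b i ∈ W.1) ∧ W.1 ⊓ K ⊔ Submodule.span F (Set.range b) = W.1 := fun W => by
    refine exists_fin_sup_span_eq inf_le_left ?_
    have h1 := Submodule.finrank_sup_add_finrank_inf_eq W.1 K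
    have h2 := Submodule.finrank_le (W.1 ⊔ K)
    omega
  choose b _ hb using hex
  let j : {W : Submodule F M // W.map f ≤ W} →
      {W : Submodule F K // W.map fK ≤ W} × (Fin t → M) := fun W =>
    (⟨W.1.comap K.subtype, by
      rintro _ ⟨y, hy, rfl⟩
      exact W.2 (Submodule.mem_map_of_mem hy)⟩, b W)
  have hj : Function.Injective j := by
    intro W W' h
    have h1 : W.1.comap K.subtype = W'.1.comap K.subtype :=
      congrArg Subtype.val (congrArg Prod.fst h)
    have h2 : b W = b W' := congrArg Prod.snd h
    have h3 := congrArg (Submodule.map K.subtype) h1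
    rw [Submodule.map_comap_subtype, Submodule.map_comap_subtype, inf_comm, inf_comm K] at h3
    refine Subtype.ext ?_
    rw [← hb W, ← hb W', h2, h3]
  have hcard := Nat.card_le_card_of_injective j hj
  rw [Nat.card_prod, Nat.card_fun, Nat.card_fin, Module.natCard_eq_pow_finrank (K := F) (V := M),
    ← pow_mul] at hcard
  have hq1 : (1 : ℝ) < Nat.card F := hx.trans_le hq
  have hq0 : (0 : ℝ) < Nat.card F := by linarith
  have hC0 := one_le_thetaSum hx
  have hD0 := one_le_eulerProd hx
  have h1 := card_stable_of_aeval_eq_zero_le hx hq fK hr hdeg hfKr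
  have hKM : (Module.finrank F K : ℝ) ≤ Module.finrank F M := by
    exact_mod_cast Submodule.finrank_le K
  calc (Nat.card {W : Submodule F M // W.map f ≤ W} : ℝ)
      ≤ (Nat.card {W : Submodule F K // W.map fK ≤ W} : ℝ) *
        (Nat.card F : ℝ) ^ (Module.finrank F M * t) := by exact_mod_cast hcard
    _ ≤ thetaSum x * eulerProd x * (Nat.card F : ℝ) ^ ((Module.finrank F K : ℝ) ^ 2 / 8) *
        (Nat.card F : ℝ) ^ (Module.finrank F M * t) := by gcongr
    _ ≤ thetaSum x * eulerProd x * (Nat.card F : ℝ) ^ ((Module.finrank F M : ℝ) ^ 2 / 8) *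
        (Nat.card F : ℝ) ^ (Module.finrank F M * t) := by
        gcongr
        exact hq1.le
    _ = _ := by
        rw [Real.rpow_add hq0, ← Nat.cast_mul, Real.rpow_natCast, mul_assoc]

/-- Left multiplication `u ↦ y ∧ u` into the exterior square. -/
noncomputable def wedgeLeft (F : Type*) {V : Type*} [Field F] [AddCommGroup V] [Module F V]
    (y : V) : V →ₗ[F] ⋀[F]^2 V :=
  (exteriorPower.ιMulti F 2).toMultilinearMap.toLinearMap ![y, 0] 1

theorem wedgeLeft_apply {F V : Type*} [Field F] [AddCommGroup V] [Module F V] (y u : V) :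
    wedgeLeft F y u = exteriorPower.ιMulti F 2 ![y, u] := by
  change exteriorPower.ιMulti F 2 (Function.update ![y, 0] 1 u) = _
  congr 1
  ext i
  fin_cases i <;> simp

theorem ιMulti_ne_zero_of_linearIndependent {F V : Type*} [Field F] [AddCommGroup V] [Module F V]
    {n : ℕ} {v : Fin n → V} (hv : LinearIndependent F v) : exteriorPower.ιMulti F n v ≠ 0 := by
  have h := (exteriorPower.ιMulti_family_linearIndependent_field (n := n) hv).ne_zero
    (Set.powersetCard.ofFinEmbEquiv (RelEmbedding.refl _))
  rw [exteriorPower.ιMulti_family, Equiv.symm_apply_apply] at h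
  exact h

theorem ker_wedgeLeft_le {F V : Type*} [Field F] [AddCommGroup V] [Module F V] {y : V}
    (hy : y ≠ 0) : LinearMap.ker (wedgeLeft F y) ≤ Submodule.span F {y} := by
  intro u hu
  by_contra hcon
  rw [LinearMap.mem_ker, wedgeLeft_apply] at hu
  refine ιMulti_ne_zero_of_linearIndependent ?_ hu
  rw [LinearIndependent.pair_iff' hy]
  intro a ha
  exact hcon (Submodule.mem_span_singleton.2 ⟨a, ha⟩)

theorem finrank_le_finrank_map_wedgeLeft_add_one {F V : Type*} [Field F] [AddCommGroup V]
    [Module F V] [FiniteDimensional F V] {y : V} (hy : y ≠ 0) (U : Submodule F V) :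
    Module.finrank F U ≤ Module.finrank F (U.map (wedgeLeft F y)) + 1 := by
  have h1 := LinearMap.finrank_range_add_finrank_ker ((wedgeLeft F y).domRestrict U)
  rw [LinearMap.range_domRestrict, LinearMap.ker_domRestrict] at h1
  have h3 := Submodule.finrank_map_subtype_eq U ((LinearMap.ker (wedgeLeft F y)).comap U.subtype)
  have h2 := Submodule.finrank_mono
    ((Submodule.map_comap_le U.subtype (LinearMap.ker (wedgeLeft F y))).trans (ker_wedgeLeft_le hy))
  rw [finrank_span_singleton hy] at h2
  omega

/-- If `g` is invertible and `λ` is an eigenvalue of small codimension both for `g` and for its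
exterior square, then `g` is trivial. -/
theorem eq_id_of_finrank_range_sub_le {F V : Type*} [Field F] [AddCommGroup V]
    [Module F V] [FiniteDimensional F V] {g : V →ₗ[F] V} (hg : Function.Injective g) (l : F)
    {t : ℕ} (ht : 2 * t + 2 ≤ Module.finrank F V)
    (h1 : Module.finrank F (LinearMap.range (g - l • LinearMap.id)) ≤ t)
    (h2 : Module.finrank F (LinearMap.range (exteriorPower.map 2 g - l • LinearMap.id)) ≤ t) :
    g = LinearMap.id := by
  set U := LinearMap.ker (g - l • LinearMap.id) with hU
  have hdim := LinearMap.finrank_range_add_finrank_ker (g - l • LinearMap.id)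
  rw [← hU] at hdim
  have hgU : ∀ u ∈ U, g u = l • u := fun u hu => by
    rw [hU, LinearMap.mem_ker] at hu
    simpa [sub_eq_zero] using hu
  have hmap : ∀ y u : V, exteriorPower.map 2 g (wedgeLeft F y u) = wedgeLeft F (g y) (g u) := by
    intro y u
    rw [wedgeLeft_apply, wedgeLeft_apply, exteriorPower.map_apply_ιMulti]
    congr 1
    ext i
    fin_cases i <;> simp
  have hupd : ∀ u a : V, Function.update ![0, u] 0 a = ![a, u] := fun u a => by
    ext i
    fin_cases i <;> simp
  have hadd : ∀ y z u : V, wedgeLeft F (y - z) u = wedgeLeft F y u - wedgeLeft F z u := by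
    intro y z u
    have := (exteriorPower.ιMulti F 2 (M := V)).map_update_sub ![0, u] 0 y z
    simpa only [wedgeLeft_apply, hupd] using this
  have hsmul : ∀ (c : F) (y u : V), wedgeLeft F (c • y) u = c • wedgeLeft F y u := by
    intro c y u
    have := (exteriorPower.ιMulti F 2 (M := V)).map_update_smul ![0, u] 0 c y
    simpa only [wedgeLeft_apply, hupd] using this
  have hno : ∀ y : V, y ≠ 0 → ¬ U.map (wedgeLeft F y) ≤
      LinearMap.range (exteriorPower.map 2 g - l • LinearMap.id) := fun y hy hle => by
    have h3 := finrank_le_finrank_map_wedgeLeft_add_one (F := F) hy U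
    have h4 := Submodule.finrank_mono hle
    omega
  obtain ⟨u₁, hu₁, hu₁0⟩ : ∃ u ∈ U, u ≠ 0 := by
    refine Submodule.exists_mem_ne_zero_of_ne_bot fun h => ?_
    rw [h, finrank_bot] at hdim
    omega
  have hl0 : l ≠ 0 := by
    rintro rfl
    exact hu₁0 (hg (by rw [hgU _ hu₁, zero_smul, map_zero]))
  have hl1 : l = 1 := by
    by_contra hl1
    refine hno u₁ hu₁0 ?_
    rintro _ ⟨u, hu, rfl⟩
    have hc : l * l - l ≠ 0 := by
      rw [← mul_sub_one]; exact mul_ne_zero hl0 (sub_ne_zero.2 hl1)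
    refine ⟨(l * l - l)⁻¹ • wedgeLeft F u₁ u, ?_⟩
    rw [map_smul, LinearMap.sub_apply, hmap, hgU _ hu₁, hgU _ hu, hsmul, map_smul,
      LinearMap.smul_apply, LinearMap.id_apply, smul_smul, ← sub_smul, smul_smul,
      inv_mul_cancel₀ hc, one_smul]
  subst hl1
  ext y
  rw [LinearMap.id_apply, ← sub_eq_zero]
  by_contra hy
  refine hno _ hy ?_
  rintro _ ⟨u, hu, rfl⟩
  refine ⟨wedgeLeft F y u, ?_⟩
  rw [LinearMap.sub_apply, hmap, hgU _ hu, one_smul, one_smul, LinearMap.id_apply, hadd]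

open Polynomial in
theorem finrank_ker_aeval_of_natDegree_eq_one {F M : Type*} [Field F] [AddCommGroup M] [Module F M]
    (f : Module.End F M) {r : F[X]} (hr : r.natDegree = 1) :
    ∃ l : F, LinearMap.ker (aeval f r) = LinearMap.ker (f - l • LinearMap.id) := by
  obtain ⟨a, b, rfl⟩ := exists_eq_X_add_C_of_natDegree_le_one hr.le
  have ha : a ≠ 0 := by
    rintro rfl
    simp at hr
  refine ⟨-b / a, ?_⟩
  ext y
  have h : (aeval f (C a * X + C b)) y = a • (f - (-b / a) • (LinearMap.id : M →ₗ[F] M)) y := by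
    simp only [map_add, map_mul, aeval_C, aeval_X, LinearMap.add_apply, Module.End.mul_apply,
      Module.algebraMap_end_apply, LinearMap.sub_apply, LinearMap.smul_apply, LinearMap.id_apply,
      smul_sub, smul_smul]
    rw [mul_div_cancel₀ _ ha, neg_smul, sub_neg_eq_add]
  rw [LinearMap.mem_ker, LinearMap.mem_ker, h, smul_eq_zero_iff_right ha]

open Polynomial in
/-- Stable subspaces of an endomorphism without an eigenspace of codimension at most three. -/
theorem card_stable_le_of_forall_finrank_ker_add_lt {F M : Type*} [Field F] [Finite F]
    [AddCommGroup M] [Module F M] [FiniteDimensional F M] {x : ℝ} (hx : 1 < x)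
    (hq : x ≤ Nat.card F) (f : Module.End F M) (hm : 40 ≤ Module.finrank F M)
    (heig : ∀ l : F, Module.finrank F (LinearMap.ker (f - l • LinearMap.id)) + 3 <
      Module.finrank F M) :
    (Nat.card {W : Submodule F M // W.map f ≤ W} : ℝ) ≤ (thetaSum x * eulerProd x) ^ 5 *
      (Nat.card F : ℝ) ^ (((Module.finrank F M : ℝ) - 4) ^ 2 / 4 + 4) := by
  have : Finite M := Module.finite_of_finite F
  have hq1 : (1 : ℝ) < Nat.card F := hx.trans_le hq
  have hCD : 1 ≤ thetaSum x * eulerProd x :=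
    one_le_mul_of_one_le_of_one_le (one_le_thetaSum hx) (one_le_eulerProd hx)
  have hm' : (40 : ℝ) ≤ Module.finrank F M := by exact_mod_cast hm
  have hmid : ∀ s : F[X], 4 ≤ Module.finrank F (LinearMap.ker (aeval f s)) →
      Module.finrank F (LinearMap.ker (aeval f s)) + 4 ≤ Module.finrank F M →
      (Nat.card {W : Submodule F M // W.map f ≤ W} : ℝ) ≤ (thetaSum x * eulerProd x) ^ 5 *
        (Nat.card F : ℝ) ^ (((Module.finrank F M : ℝ) - 4) ^ 2 / 4 + 4) := by
    intro s h1 h2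
    have hsub : Nat.card {W : Submodule F M // W.map f ≤ W} ≤
        Nat.card {W : Submodule F M // W.map (aeval f s : Module.End F M) ≤ W} :=
      Nat.card_le_card_of_injective (fun W => ⟨W.1, map_aeval_le W.2 s⟩) fun W W' h =>
        Subtype.ext (Subtype.mk.inj h)
    have hdim := LinearMap.finrank_range_add_finrank_ker (aeval f s)
    refine (Nat.cast_le.2 hsub).trans ((card_stable_le hx hq _).trans ?_)
    refine mul_le_mul (pow_le_pow_right₀ hCD (by norm_num)) ?_ (by positivity) (by positivity)
    refine Real.rpow_le_rpow_of_exponent_le hq1.le ?_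
    set n := Module.finrank F (LinearMap.ker (aeval f s))
    set k := Module.finrank F (LinearMap.range (aeval f s))
    rw [← hdim]
    have hn : (4 : ℝ) ≤ n := by exact_mod_cast h1
    have hk : (4 : ℝ) ≤ k := by
      have : 4 ≤ k := by omega
      exact_mod_cast this
    push_cast
    nlinarith [mul_nonneg (sub_nonneg.2 hn) (sub_nonneg.2 hk)]
  by_cases hirr : ∀ r : F[X], Irreducible r → Module.finrank F (LinearMap.ker (aeval f r)) ≤ 3
  · obtain ⟨s, h1, h2⟩ := exists_finrank_ker_aeval_mem_Icc f hirr (by omega)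
    exact hmid s (by omega) (by omega)
  · push Not at hirr
    obtain ⟨r, hr, h1⟩ := hirr
    by_cases h2 : Module.finrank F (LinearMap.ker (aeval f r)) + 4 ≤ Module.finrank F M
    · exact hmid r (by omega) h2
    · have hdeg : 2 ≤ r.natDegree := by
        by_contra hlt
        have hpos := hr.natDegree_pos
        obtain ⟨l, hl⟩ := finrank_ker_aeval_of_natDegree_eq_one f (r := r) (by omega)
        have := heig l
        rw [← hl] at this
        omega
      refine (card_stable_of_finrank_le hx hq f hr hdeg (t := 3) (by omega)).trans ?_
      refine mul_le_mul ?_ ?_ (by positivity) (by positivity)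
      · exact le_self_pow₀ hCD (by norm_num)
      · refine Real.rpow_le_rpow_of_exponent_le hq1.le ?_
        push_cast
        nlinarith

theorem theorem6p3 (p : ℕ) [Fact p.Prime] (d : ℕ) (hd : 2 ≤ d)
    (g : Matrix.GeneralLinearGroup (Fin d) (ZMod p)) (hg : g ≠ 1)
    {V M : Type*}
    [AddCommGroup V] [Module (ZMod p) V] [FiniteDimensional (ZMod p) V]
    [AddCommGroup M] [Module (ZMod p) M]
    (ρV : Representation (ZMod p) (Subgroup.zpowers g) V)
    (ρM : Representation (ZMod p) (Subgroup.zpowers g) M)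
    (hV : ρV ⟨g, Subgroup.mem_zpowers g⟩ ≠ LinearMap.id)
    (hM : IsRepExtension (exteriorSquareRep ρV) ρM ρV)
    (v m : ℕ) (hv : v = Module.finrank (ZMod p) V) (hm : m = Module.finrank (ZMod p) M)
    (ε : ℝ) (hε : ε = Real.logb p (thetaSum p * eulerProd p)) :
    m = v * (v + 1) / 2 ∧
    Finite (Subrepresentation ρM) ∧
    Real.logb p (Nat.card (Subrepresentation ρM)) ≤
      ((m : ℝ) - 4) ^ 2 / 4 + (if m ≤ 45 then ε + 2 * (m : ℝ) - 4 else 5 * ε + 4) := by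
  obtain ⟨i, π, hi, hex, hπ⟩ := hM
  have hker : LinearMap.range i.toLinearMap = LinearMap.ker π.toLinearMap :=
    (LinearMap.exact_iff (f := i.toLinearMap) (g := π.toLinearMap) |>.1 hex).symm
  have : IsNoetherian (ZMod p) M := isNoetherian_of_range_eq_ker i.toLinearMap π.toLinearMap hker
  have hdim : m = v.choose 2 + v := by
    have h := LinearMap.finrank_range_add_finrank_ker π.toLinearMap
    rw [← hker, LinearMap.finrank_range_of_inj hi, exteriorPower.finrank_eq,
      LinearMap.range_eq_top.2 hπ, finrank_top] at h
    rw [hm, ← h, hv, add_comm]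
  have hmv : m = v * (v + 1) / 2 := by
    rw [hdim, Nat.choose_two_right]
    rcases v with _ | v
    · rfl
    · have : (v + 1) * (v + 1 + 1) = (v + 1) * (v + 1 - 1) + (v + 1) * 2 := by
        rw [← mul_add]; rfl
      rw [this, Nat.add_mul_div_right _ _ two_pos]
  have : Finite M := Module.finite_of_finite (ZMod p)
  have hfin : Finite (Subrepresentation ρM) :=
    Finite.of_injective _ Subrepresentation.toSubmodule_injective
  refine ⟨hmv, hfin, ?_⟩
  have hx : (1 : ℝ) < p := by exact_mod_cast (Fact.out : p.Prime).one_lt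
  have hx0 : (0 : ℝ) < p := by linarith
  have hcardF : Nat.card (ZMod p) = p := Nat.card_zmod p
  have hq : (p : ℝ) ≤ Nat.card (ZMod p) := by rw [hcardF]
  have hCD : 1 ≤ thetaSum p * eulerProd p :=
    one_le_mul_of_one_le_of_one_le (one_le_thetaSum hx) (one_le_eulerProd hx)
  have hne : Nonempty (Subrepresentation ρM) := ⟨⊤⟩
  have hSpos : (0 : ℝ) < Nat.card (Subrepresentation ρM) := by exact_mod_cast Nat.card_pos
  split_ifs with h45
  · have h1 : (Nat.card (Subrepresentation ρM) : ℝ) ≤ Nat.card (Submodule (ZMod p) M) :=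
      Nat.cast_le.2 (Nat.card_le_card_of_injective _ Subrepresentation.toSubmodule_injective)
    have h2 := h1.trans (card_submodule_le hx hq)
    rw [hcardF, ← hm] at h2
    have h3 := Real.logb_le_logb_of_le hx hSpos h2
    rw [Real.logb_mul (by positivity) (by positivity), Real.logb_rpow hx0 hx.ne', ← hε] at h3
    linarith
  · set g₀ : Subgroup.zpowers g := ⟨g, Subgroup.mem_zpowers g⟩
    set f : M →ₗ[ZMod p] M := ρM g₀
    have hv10 : 10 ≤ v := by
      by_contra hlt
      have : v * (v + 1) ≤ 9 * 10 := Nat.mul_le_mul (by omega) (by omega)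
      omega
    have hinj : Function.Injective (ρV g₀) := by
      refine Function.LeftInverse.injective (g := ρV g₀⁻¹) fun y => ?_
      rw [← Module.End.mul_apply, ← map_mul, inv_mul_cancel, map_one, Module.End.one_apply]
    have heig : ∀ l : ZMod p, Module.finrank (ZMod p) (LinearMap.ker (f - l • LinearMap.id)) + 3 <
        Module.finrank (ZMod p) M := by
      intro l
      by_contra hlt
      have hrank := LinearMap.finrank_range_add_finrank_ker (f - l • LinearMap.id)
      refine hV (eq_id_of_finrank_range_sub_le hinj l (t := 3) (by omega) ?_ ?_)
      · have hcomm : (ρV g₀ - l • LinearMap.id) ∘ₗ π.toLinearMap =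
            π.toLinearMap ∘ₗ (f - l • LinearMap.id) := by
          rw [LinearMap.sub_comp, LinearMap.comp_sub, π.isIntertwining' g₀]
          ext y
          simp
        have hle : LinearMap.range (ρV g₀ - l • LinearMap.id) =
            (LinearMap.range (f - l • LinearMap.id)).map π.toLinearMap := by
          rw [← LinearMap.range_comp, ← hcomm,
            LinearMap.range_comp_of_range_eq_top _ (LinearMap.range_eq_top.2 hπ)]
        rw [hle]
        refine (Submodule.finrank_map_le _ _).trans ?_
        omega
      · have hcomm : (f - l • LinearMap.id) ∘ₗ i.toLinearMap =
            i.toLinearMap ∘ₗ (exteriorPower.map 2 (ρV g₀) - l • LinearMap.id) := by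
          rw [LinearMap.sub_comp, LinearMap.comp_sub]
          have := i.isIntertwining' g₀
          change i.toLinearMap ∘ₗ exteriorPower.map 2 (ρV g₀) = f ∘ₗ i.toLinearMap at this
          rw [this]
          congr 1
          refine LinearMap.ext fun y => ?_
          simp
        have hle : (LinearMap.range
            (exteriorPower.map 2 (ρV g₀) - l • LinearMap.id)).map i.toLinearMap ≤
            LinearMap.range (f - l • LinearMap.id) := by
          rw [← LinearMap.range_comp, ← hcomm]
          exact LinearMap.range_comp_le_range _ _
        have h1 := Submodule.finrank_mono hle
        rw [(Submodule.equivMapOfInjective _ hi _).finrank_eq.symm] at h1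
        omega
    have hsub : (Nat.card (Subrepresentation ρM) : ℝ) ≤
        Nat.card {W : Submodule (ZMod p) M // W.map f ≤ W} :=
      Nat.cast_le.2 (Nat.card_le_card_of_injective
        (fun W : Subrepresentation ρM => ⟨W.toSubmodule, by
          rintro _ ⟨y, hy, rfl⟩
          exact W.apply_mem_toSubmodule g₀ hy⟩)
        fun W W' h => Subrepresentation.toSubmodule_injective (congrArg Subtype.val h))
    have h2 := hsub.trans
      (card_stable_le_of_forall_finrank_ker_add_lt hx hq f (by omega) heig)
    rw [hcardF, ← hm] at h2
    have h3 := Real.logb_le_logb_of_le hx hSpos h2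
    rw [Real.logb_mul (by positivity) (by positivity), Real.logb_rpow hx0 hx.ne', Real.logb_pow,
      ← hε] at h3
    push_cast at h3
    linarith
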